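/- **Theorem (properties of the random-horizon stochastic policy gradients).** Consider a discounted Markov decision process with measurable state space $\mathcal S$ and action space $\mathcal A$ (for instance finite sets, or compact subsets of Euclidean spaces), transition kernel $P(ds'\mid s,a)$, measurable reward $R:\mathcal S\times\mathcal A\to\mathbb R$, discount factor $\gamma\in(0,1)$ and initial state $s_0$. Let $\pi_\theta(a\mid s)$, $\theta\in\mathbb R^d$, be policies given by probability densities on $\mathcal A$ with respect to a $\sigma$-finite reference measure (counting measure or Lebesgue measure in the examples), measurable in $(s,a)$. Assume: (i) $|R(s,a)|\le U_R$ for all $(s,a)$; (ii) for all $(s,a)$, $\pi_\theta(a\mid s)$ is positive and differentiable in $\theta$, and the score function $\nabla\log\pi_\theta(a\mid s)$ (gradient in $\theta$) satisfies $\|\nabla\log\pi_{\theta^1}(a\mid s)-\nabla\log\pi_{\theta^2}(a\mid s)\|\le L_\Theta\|\theta^1-\theta^2\|$ and $\|\nabla\log\pi_\theta(a\mid s)\|\le B_\Theta$ for all $\theta,\theta^1,\theta^2\in\mathbb R^d$, with constants $L_\Theta$ and $B_\Theta>0$. Under the policy $\pi_\theta$, let $Q_{\pi_\theta}(s,a)=\mathbb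 E[\sum_{t\ge0}\gamma^tR(s_t,a_t)\mid s_0=s,a_0=a]$ and $V_{\pi_\theta}(s)=\mathbb E[\sum_{t\ge0}\gamma^tR(s_t,a_t)\mid s_0=s]$, and put $J(\theta)=V_{\pi_\theta}(s_0)$. Let $\rho_\theta=(1-\gamma)\sum_{t\ge0}\gamma^t\,\mathrm{Law}(s_t,a_t\mid s_0,\pi_\theta)$ be the discounted state-action occupancy measure. Write $T\sim\mathrm{Geom}(p)$ if $\mathbb P(T=t)=p(1-p)^t$ for $t=0,1,2,\dots$ *Sampling.* For fixed $\theta$, draw $T\sim\mathrm{Geom}(1-\gamma)$ and, independently, a trajectory $(s_0,a_0,s_1,a_1,\dots)$ from $s_0$ under $\pi_\theta$, and keep $(s_T,a_T)$. Given $(s,a)$, let $\hat Q_{\pi_\theta}(s,a)=\sum_{t=0}^{T'}\gamma^{t/2}R(s_t,a_t)$ along a fresh trajectory under $\pi_\theta$ started at $s_0=s,a_0=a$, with an independent horizon $T'\sim\mathrm{Geom}(1-\gamma^{1/2})$. Given $s$, let $\hat V_{\pi_\theta}(s)$ be the same sum along a fresh trajectory started at $s_0=s$, $a_0\sim\pi_\theta(\cdot\mid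 s)$, with a fresh independent horizon $T'\sim\mathrm{Geom}(1-\gamma^{1/2})$. Different calls use independent randomness. Finally let $s_T'\sim P(\cdot\mid s_T,a_T)$ be a fresh next state. Define $$\hat\nabla J(\theta)=\tfrac1{1-\gamma}\,\hat Q_{\pi_\theta}(s_T,a_T)\,\nabla\log\pi_\theta(a_T\mid s_T),$$ $$\check\nabla J(\theta)=\tfrac1{1-\gamma}\,[\hat Q_{\pi_\theta}(s_T,a_T)-\hat V_{\pi_\theta}(s_T)]\,\nabla\log\pi_\theta(a_T\mid s_T),$$ $$\tilde\nabla J(\theta)=\tfrac1{1-\gamma}\,[R(s_T,a_T)+\gamma\hat V_{\pi_\theta}(s_T')-\hat V_{\pi_\theta}(s_T)]\,\nabla\log\pi_\theta(a_T\mid s_T).$$ *Conclusion.* For every $\theta\in\mathbb R^d$, $J$ is differentiable at $\theta$ with $\nabla J(\theta)=\frac1{1-\gamma}\mathbb E_{(s,a)\sim\rho_\theta}[Q_{\pi_\theta}(s,a)\,\nabla\log\pi_\theta(a\mid s)]$; the three estimators are integrable and unbiased, $$\mathbb E[\hat\nabla J(\theta)]=\mathbb E[\check\nabla J(\theta)]=\mathbb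 E[\tilde\nabla J(\theta)]=\nabla J(\theta);$$ and $$\|\nabla J(\theta)\|\le\frac{B_\Theta U_R}{(1-\gamma)^2},\qquad \|\hat\nabla J(\theta)\|\le\hat\ell,\quad\|\check\nabla J(\theta)\|\le\check\ell,\quad\|\tilde\nabla J(\theta)\|\le\tilde\ell\quad\text{almost surely},$$ where $$\hat\ell=\frac{B_\Theta U_R}{(1-\gamma)(1-\gamma^{1/2})},\qquad \check\ell=\frac{2B_\Theta U_R}{(1-\gamma)(1-\gamma^{1/2})},\qquad \tilde\ell=\frac{(2+\gamma-\gamma^{1/2})B_\Theta U_R}{(1-\gamma)(1-\gamma^{1/2})}.$$ These three constants are positive whenever $U_R>0$. -/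

import Mathlib

open MeasureTheory ProbabilityTheory
open scoped Gradient

/-- A discounted Markov decision process with state space `S` and action space `A`:
transition kernel `P(ds' | s, a)`, reward `R(s, a)` and discount factor `γ ∈ (0, 1)`. -/
structure MDP (S A : Type*) [MeasurableSpace S] [MeasurableSpace A] where
  P : Kernel (S × A) S
  isMarkovKernel_P : IsMarkovKernel P
  R : S × A → ℝ
  measurable_R : Measurable R
  γ : ℝ
  γ_pos : 0 < γ
  γ_lt_one : γ < 1

/-- A family of stochastic policies `π_θ(a | s)`, `θ ∈ ℝ^d`, given by probability densities with
respect to a reference measure `ν` on the action space (the counting measure when actions are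
finitely many, the Lebesgue measure when they form a subset of a Euclidean space). -/
structure ParamPolicy (d : ℕ) (S : Type*) {A : Type*} [MeasurableSpace S] [MeasurableSpace A]
    (ν : Measure A) where
  dens : EuclideanSpace ℝ (Fin d) → S → A → ℝ
  dens_nonneg : ∀ θ s a, 0 ≤ dens θ s a
  measurable_dens : ∀ θ, Measurable (fun x : S × A => dens θ x.1 x.2)
  lintegral_dens : ∀ θ s, ∫⁻ a, ENNReal.ofReal (dens θ s a) ∂ν = 1

namespace ParamPolicy

variable {d : ℕ} {S A : Type*} [MeasurableSpace S] [MeasurableSpace A] {ν : Measure A}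

/-- The Markov kernel `π_θ(da | s)`. -/
noncomputable def kernel [SigmaFinite ν] (π : ParamPolicy d S ν)
    (θ : EuclideanSpace ℝ (Fin d)) : Kernel S A :=
  Kernel.withDensity (Kernel.const S ν) (fun s a => ENNReal.ofReal (π.dens θ s a))

instance [SigmaFinite ν] (π : ParamPolicy d S ν) (θ : EuclideanSpace ℝ (Fin d)) :
    IsMarkovKernel (π.kernel θ) := by
  refine ⟨fun s => ⟨?_⟩⟩
  have h : Measurable (Function.uncurry fun s a => ENNReal.ofReal (π.dens θ s a)) :=
    (π.measurable_dens θ).ennreal_ofReal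
  rw [kernel, Kernel.withDensity_apply' _ h]
  simpa using π.lintegral_dens θ s

/-- The score function `∇_θ log π_θ(a | s)` at the pair `x = (s, a)`. -/
noncomputable def score (π : ParamPolicy d S ν) (θ : EuclideanSpace ℝ (Fin d)) (x : S × A) :
    EuclideanSpace ℝ (Fin d) :=
  ∇ (fun θ' => Real.log (π.dens θ' x.1 x.2)) θ

end ParamPolicy

namespace MDP

variable {S A : Type*} [MeasurableSpace S] [MeasurableSpace A]

instance (M : MDP S A) : IsMarkovKernel M.P := M.isMarkovKernel_P

/-! ### Trajectories, value functions -/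

/-- One step of the state-action chain: `s' ∼ P(· | s, a)`, then `a' ∼ κ(· | s')`. -/
noncomputable def step (M : MDP S A) (κ : Kernel S A) [IsMarkovKernel κ] :
    Kernel (S × A) (S × A) :=
  M.P.compProd (Kernel.prodMkLeft (S × A) κ)

instance (M : MDP S A) (κ : Kernel S A) [IsMarkovKernel κ] : IsMarkovKernel (M.step κ) := by
  unfold step; infer_instance

/-- The law of the next state-action pair given the history `(s_0, a_0), …, (s_n, a_n)`. -/
noncomputable def histStep (M : MDP S A) (κ : Kernel S A) [IsMarkovKernel κ] (n : ℕ) :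
    Kernel (Finset.Iic n → S × A) (S × A) :=
  (M.step κ).comap (fun h => h ⟨n, Finset.mem_Iic.2 le_rfl⟩) (measurable_pi_apply _)

instance (M : MDP S A) (κ : Kernel S A) [IsMarkovKernel κ] (n : ℕ) :
    IsMarkovKernel (M.histStep κ n) := by
  unfold histStep; infer_instance

/-- The law of the trajectory `(s_0, a_0), (s_1, a_1), …` started at `s_0 = s`, `a_0 = a`. -/
noncomputable def trajQ (M : MDP S A) (κ : Kernel S A) [IsMarkovKernel κ] :
    Kernel (S × A) (ℕ → S × A) :=
  (Kernel.traj (X := fun _ => S × A) (M.histStep κ) 0).comap (fun x _ => x)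
    (measurable_pi_lambda _ fun _ => measurable_id)

instance (M : MDP S A) (κ : Kernel S A) [IsMarkovKernel κ] : IsMarkovKernel (M.trajQ κ) := by
  unfold trajQ; infer_instance

/-- The law of the trajectory `(s_0, a_0), (s_1, a_1), …` started at `s_0 = s`, with
`a_0 ∼ κ(· | s)`. -/
noncomputable def trajV (M : MDP S A) (κ : Kernel S A) [IsMarkovKernel κ] :
    Kernel S (ℕ → S × A) :=
  (M.trajQ κ).comp (Kernel.id.prod κ)

instance (M : MDP S A) (κ : Kernel S A) [IsMarkovKernel κ] : IsMarkovKernel (M.trajV κ) := by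
  unfold trajV; infer_instance

/-- The action-value function `Q(s, a) = E[∑_t γ^t R(s_t, a_t) | s_0 = s, a_0 = a]`. -/
noncomputable def Q (M : MDP S A) (κ : Kernel S A) [IsMarkovKernel κ] (x : S × A) : ℝ :=
  ∫ ω, ∑' t : ℕ, M.γ ^ t * M.R (ω t) ∂(M.trajQ κ x)

/-- The state-value function `V(s) = E[∑_t γ^t R(s_t, a_t) | s_0 = s]`. -/
noncomputable def V (M : MDP S A) (κ : Kernel S A) [IsMarkovKernel κ] (s : S) : ℝ :=
  ∫ ω, ∑' t : ℕ, M.γ ^ t * M.R (ω t) ∂(M.trajV κ s)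

/-- The discounted state-action occupancy measure
`ρ(ds, da) = (1 - γ) ∑_t γ^t P(s_t ∈ ds, a_t ∈ da | s_0)`. -/
noncomputable def occupancy (M : MDP S A) (κ : Kernel S A) [IsMarkovKernel κ] (s₀ : S) :
    Measure (S × A) :=
  Measure.sum fun t : ℕ =>
    ENNReal.ofReal ((1 - M.γ) * M.γ ^ t) • (M.trajV κ s₀).map (fun ω => ω t)

/-! ### Random horizons and rollouts -/

/-- The law `Geom(1 - γ)` of the outer horizon: `P(T = t) = (1 - γ) γ ^ t`. -/
noncomputable def outerHorizon (M : MDP S A) : Measure ℕ :=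
  geometricMeasure ⟨1 - M.γ, sub_nonneg.2 M.γ_lt_one.le, sub_le_self _ M.γ_pos.le⟩

/-- The law `Geom(1 - γ^{1/2})` of the rollout horizon: `P(T' = t) = (1 - γ^{1/2}) γ ^ {t/2}`. -/
noncomputable def innerHorizon (M : MDP S A) : Measure ℕ :=
  geometricMeasure ⟨1 - √M.γ,
    sub_nonneg.2 (Real.sqrt_le_one.2 M.γ_lt_one.le), sub_le_self _ (Real.sqrt_nonneg _)⟩

instance (M : MDP S A) : IsProbabilityMeasure M.outerHorizon := by
  unfold outerHorizon; infer_instance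

instance (M : MDP S A) : IsProbabilityMeasure M.innerHorizon := by
  unfold innerHorizon; infer_instance

/-- A horizon together with a trajectory. -/
abbrev Rollout (S A : Type*) := ℕ × (ℕ → S × A)

/-- Randomness of the subroutine estimating `Q(s, a)`: an independent pair of a horizon
`T' ∼ Geom(1 - γ^{1/2})` and a trajectory started at `(s, a)`. -/
noncomputable def rolloutQ (M : MDP S A) (κ : Kernel S A) [IsMarkovKernel κ] :
    Kernel (S × A) (Rollout S A) :=
  (Kernel.const (S × A) M.innerHorizon).prod (M.trajQ κ)

/-- Randomness of the subroutine estimating `V(s)`: an independent pair of a horizon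
`T' ∼ Geom(1 - γ^{1/2})` and a trajectory started at `s`. -/
noncomputable def rolloutV (M : MDP S A) (κ : Kernel S A) [IsMarkovKernel κ] :
    Kernel S (Rollout S A) :=
  (Kernel.const S M.innerHorizon).prod (M.trajV κ)

instance (M : MDP S A) (κ : Kernel S A) [IsMarkovKernel κ] : IsMarkovKernel (M.rolloutQ κ) := by
  unfold rolloutQ; infer_instance

instance (M : MDP S A) (κ : Kernel S A) [IsMarkovKernel κ] : IsMarkovKernel (M.rolloutV κ) := by
  unfold rolloutV; infer_instance

/-- The value `∑_{t=0}^{T'} γ^{t/2} R(s_t, a_t)` returned by either subroutine. -/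
noncomputable def rolloutReturn (M : MDP S A) (r : Rollout S A) : ℝ :=
  ∑ t ∈ Finset.range (r.1 + 1), √M.γ ^ t * M.R (r.2 t)

/-- The law of the outer sample: an independent pair of a horizon `T ∼ Geom(1 - γ)` and a
trajectory started at `s₀`. -/
noncomputable def outerSample (M : MDP S A) (κ : Kernel S A) [IsMarkovKernel κ] (s₀ : S) :
    Measure (Rollout S A) :=
  M.outerHorizon.prod (M.trajV κ s₀)

/-- The last pair `(s_T, a_T)` of an outer sample. -/
def lastPair (r : Rollout S A) : S × A := r.2 r.1

theorem measurable_lastPair : Measurable (lastPair : Rollout S A → S × A) :=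
  measurable_from_prod_countable_right fun n => measurable_pi_apply n

/-! ### The probability spaces of the three estimators

In each case the outer sample is drawn first; given it, each call of a subroutine uses fresh
independent randomness. -/

/-- Outer sample, followed by a rollout from `(s_T, a_T)`. -/
noncomputable def lawHat (M : MDP S A) (κ : Kernel S A) [IsMarkovKernel κ] (s₀ : S) :
    Measure (Rollout S A × Rollout S A) :=
  (M.outerSample κ s₀).compProd ((M.rolloutQ κ).comap lastPair measurable_lastPair)

/-- Outer sample, followed by a rollout from `(s_T, a_T)` and a rollout from `s_T`. -/
noncomputable def lawCheck (M : MDP S A) (κ : Kernel S A) [IsMarkovKernel κ] (s₀ : S) :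
    Measure (Rollout S A × (Rollout S A × Rollout S A)) :=
  (M.outerSample κ s₀).compProd
    (((M.rolloutQ κ).prod ((M.rolloutV κ).comap Prod.fst measurable_fst)).comap
      lastPair measurable_lastPair)

/-- Outer sample, followed by a next state `s'_T ∼ P(· | s_T, a_T)` with a rollout from `s'_T`,
and by a rollout from `s_T`. -/
noncomputable def lawTilde (M : MDP S A) (κ : Kernel S A) [IsMarkovKernel κ] (s₀ : S) :
    Measure (Rollout S A × ((S × Rollout S A) × Rollout S A)) :=
  (M.outerSample κ s₀).compProd
    (((M.P.compProd (Kernel.prodMkLeft (S × A) (M.rolloutV κ))).prod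
      ((M.rolloutV κ).comap Prod.fst measurable_fst)).comap lastPair measurable_lastPair)

variable {d : ℕ} {ν : Measure A}

/-- The objective `J(θ) = V_{π_θ}(s₀)`. -/
noncomputable def J [SigmaFinite ν] (M : MDP S A) (π : ParamPolicy d S ν) (s₀ : S)
    (θ : EuclideanSpace ℝ (Fin d)) : ℝ :=
  M.V (π.kernel θ) s₀

/-- `(1 - γ)⁻¹ Q̂(s_T, a_T) ∇ log π_θ(a_T | s_T)`. -/
noncomputable def gradHat (M : MDP S A) (π : ParamPolicy d S ν) (θ : EuclideanSpace ℝ (Fin d))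
    (ω : Rollout S A × Rollout S A) : EuclideanSpace ℝ (Fin d) :=
  (1 / (1 - M.γ) * M.rolloutReturn ω.2) • π.score θ (lastPair ω.1)

/-- `(1 - γ)⁻¹ [Q̂(s_T, a_T) - V̂(s_T)] ∇ log π_θ(a_T | s_T)`. -/
noncomputable def gradCheck (M : MDP S A) (π : ParamPolicy d S ν) (θ : EuclideanSpace ℝ (Fin d))
    (ω : Rollout S A × (Rollout S A × Rollout S A)) : EuclideanSpace ℝ (Fin d) :=
  (1 / (1 - M.γ) * (M.rolloutReturn ω.2.1 - M.rolloutReturn ω.2.2)) • π.score θ (lastPair ω.1)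

/-- `(1 - γ)⁻¹ [R(s_T, a_T) + γ V̂(s'_T) - V̂(s_T)] ∇ log π_θ(a_T | s_T)`. -/
noncomputable def gradTilde (M : MDP S A) (π : ParamPolicy d S ν) (θ : EuclideanSpace ℝ (Fin d))
    (ω : Rollout S A × ((S × Rollout S A) × Rollout S A)) : EuclideanSpace ℝ (Fin d) :=
  (1 / (1 - M.γ) * (M.R (lastPair ω.1) + M.γ * M.rolloutReturn ω.2.1.2
    - M.rolloutReturn ω.2.2)) • π.score θ (lastPair ω.1)

/-- The standing regularity assumption: the reward is bounded by `U_R`; the densities are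
differentiable in `θ`; the score function exists everywhere (so the densities are positive), is
`L_Θ`-Lipschitz in `θ`, and is bounded by `B_Θ > 0`. -/
structure Regular (M : MDP S A) (π : ParamPolicy d S ν) (U_R L_Θ B_Θ : ℝ) : Prop where
  reward_bound : ∀ s a, |M.R (s, a)| ≤ U_R
  dens_pos : ∀ θ s a, 0 < π.dens θ s a
  differentiable : ∀ s a, Differentiable ℝ (fun θ => π.dens θ s a)
  score_lipschitz : ∀ θ₁ θ₂ s a, ‖π.score θ₁ (s, a) - π.score θ₂ (s, a)‖ ≤ L_Θ * ‖θ₁ - θ₂‖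
  B_pos : 0 < B_Θ
  score_bound : ∀ θ s a, ‖π.score θ (s, a)‖ ≤ B_Θ

end MDP

/-! ### Bounded integrands and geometrically weighted series -/

section BoundedIntegrals

variable {X E : Type*} [MeasurableSpace X] [NormedAddCommGroup E]

/-! Differentiation under the infinite-horizon expectation is avoided. The performance difference
identity, with importance weights (`mul_V_sub_V_eq_integral_ratio`), writes `(1 - γ)(J θ' - J θ)` as
the integral of `(ratio - 1) * Q_θ'` against the occupancy measure of the fixed parameter `θ`. The
score is bounded and Lipschitz, so `ratio - 1` equals `⟪score, θ' - θ⟫` up to `O(‖θ' - θ‖²)`,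
uniformly in `(s, a)`. The same identity together with the Bellman equation gives `Q_θ' - Q_θ =
O(‖θ' - θ‖)`. Hence `J` has a first-order expansion with quadratic error, and its linear part is the
policy gradient.

Unbiasedness comes from two geometric horizons. The outer one has the occupancy weights, so `(s_T,
a_T)` has law `ρ_θ`. The inner one satisfies `P(T' ≥ t) = γ^{t/2}`, which together with the weight
`γ^{t/2}` restores `γ^t`; the rollouts therefore have conditional means `Q` and `V`. Given `(s, a)`,
the bracket in the second estimator has mean `Q - V`, and so has that in the third, by Bellman. The
term `V(s)` is a baseline: under `ρ_θ` the action is drawn from the policy given the state, and the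
score has mean zero under the policy. The norm bounds hold pointwise, by summing geometric series.
-/

theorem norm_integral_le_of_forall_norm_le [NormedSpace ℝ E] {f : X → E} {C : ℝ}
    (hC : ∀ x, ‖f x‖ ≤ C) (μ : Measure X) [IsProbabilityMeasure μ] : ‖∫ x, f x ∂μ‖ ≤ C := by
  simpa using norm_integral_le_of_norm_le_const (ae_of_all μ hC)

theorem abs_integral_le_of_forall_abs_le {f : X → ℝ} {C : ℝ}
    (hC : ∀ x, |f x| ≤ C) (μ : Measure X) [IsProbabilityMeasure μ] : |∫ x, f x ∂μ| ≤ C :=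
  norm_integral_le_of_forall_norm_le (fun x => (Real.norm_eq_abs (f x)).trans_le (hC x)) μ

variable [MeasurableSpace E] [BorelSpace E] [SecondCountableTopology E]

theorem Measurable.integrable_of_norm_le {f : X → E} (hf : Measurable f) {C : ℝ}
    (hC : ∀ x, ‖f x‖ ≤ C) (μ : Measure X) [IsFiniteMeasure μ] : Integrable f μ :=
  Integrable.of_bound hf.aestronglyMeasurable C (ae_of_all _ hC)

theorem Measurable.integral_kernel [NormedSpace ℝ E] {Y : Type*} [MeasurableSpace Y]
    {f : X → E} (hf : Measurable f) (κ : Kernel Y X) [IsSFiniteKernel κ] :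
    Measurable fun y => ∫ x, f x ∂(κ y) :=
  (hf.stronglyMeasurable.integral_kernel (κ := κ)).measurable

theorem summable_pow_mul_of_abs_le {γ U : ℝ} (h0 : 0 ≤ γ) (h1 : γ < 1) {c : ℕ → ℝ}
    (hc : ∀ t, |c t| ≤ U) : Summable fun t => γ ^ t * c t := by
  refine Summable.of_norm_bounded ((summable_geometric_of_lt_one h0 h1).mul_right U) fun t => ?_
  rw [Real.norm_eq_abs, abs_mul, abs_of_nonneg (pow_nonneg h0 t)]
  exact mul_le_mul_of_nonneg_left (hc t) (pow_nonneg h0 t)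

theorem abs_tsum_pow_mul_le {γ U : ℝ} (h0 : 0 ≤ γ) (h1 : γ < 1) {c : ℕ → ℝ}
    (hc : ∀ t, |c t| ≤ U) : |∑' t, γ ^ t * c t| ≤ U / (1 - γ) := by
  have h := (hasSum_geometric_of_lt_one h0 h1).mul_right U
  rw [div_eq_inv_mul]
  rw [← Real.norm_eq_abs]
  refine tsum_of_norm_bounded h fun t => ?_
  rw [Real.norm_eq_abs, abs_mul, abs_of_nonneg (pow_nonneg h0 t)]
  exact mul_le_mul_of_nonneg_left (hc t) (pow_nonneg h0 t)

theorem measurable_tsum_pow_mul {γ U : ℝ} (h0 : 0 ≤ γ) (h1 : γ < 1) {g : ℕ → X → ℝ}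
    (hg : ∀ t, Measurable (g t)) (hU : ∀ t x, |g t x| ≤ U) :
    Measurable fun x => ∑' t, γ ^ t * g t x := by
  refine measurable_of_tendsto_metrizable
    (f := fun n x => ∑ t ∈ Finset.range n, γ ^ t * g t x)
    (fun n => Finset.measurable_sum _ fun t _ => (hg t).const_mul _) ?_
  refine tendsto_pi_nhds.2 fun x => ?_
  exact (summable_pow_mul_of_abs_le h0 h1 fun t => hU t x).hasSum.tendsto_sum_nat

theorem integral_tsum_pow_mul {γ U : ℝ} (h0 : 0 ≤ γ) (h1 : γ < 1) {g : ℕ → X → ℝ}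
    (hg : ∀ t, Measurable (g t)) (hU : ∀ t x, |g t x| ≤ U)
    (μ : Measure X) [IsProbabilityMeasure μ] :
    ∫ x, ∑' t, γ ^ t * g t x ∂μ = ∑' t, γ ^ t * ∫ x, g t x ∂μ := by
  have hb : ∀ t x, ‖γ ^ t * g t x‖ ≤ γ ^ t * U := fun t x => by
    rw [Real.norm_eq_abs, abs_mul, abs_of_nonneg (pow_nonneg h0 t)]
    exact mul_le_mul_of_nonneg_left (hU t x) (pow_nonneg h0 t)
  rw [← integral_tsum_of_summable_integral_norm
    (fun t => ((hg t).const_mul _).integrable_of_norm_le (hb t) μ)]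
  · simp_rw [integral_const_mul]
  · refine Summable.of_norm_bounded ((summable_geometric_of_lt_one h0 h1).mul_right U) fun t => ?_
    refine norm_integral_le_of_forall_norm_le (fun x => ?_) μ
    rw [norm_norm]
    exact hb t x

end BoundedIntegrals

/-! ### Marginals of the trajectory and the Bellman equation -/

namespace MDP

variable {S A : Type*} [MeasurableSpace S] [MeasurableSpace A] (M : MDP S A) (κ : Kernel S A)
  [IsMarkovKernel κ]

instance (t : ℕ) : IsMarkovKernel (M.step κ ^ t) := by
  induction t with
  | zero => exact inferInstanceAs (IsMarkovKernel Kernel.id)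
  | succ n ih =>
    rw [pow_succ]
    exact inferInstanceAs (IsMarkovKernel ((M.step κ ^ n) ∘ₖ M.step κ))

/-- `histStep` looks only at the last coordinate of the history, so the law at time `n + 1` is the
image of the law at time `n` under `step`. This reduces expectations along trajectories to powers of
one kernel. -/
theorem map_trajQ (x : S × A) (t : ℕ) :
    (M.trajQ κ x).map (fun ω => ω t) = (M.step κ ^ t) x := by
  have hx : M.trajQ κ x =
      Kernel.traj (X := fun _ => S × A) (M.histStep κ) 0 (fun _ => x) := rfl
  rw [hx]
  induction t with
  | zero =>
    have h := Kernel.traj_map_frestrictLe_apply (X := fun _ => S × A)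
      (κ := M.histStep κ) 0 0 (fun _ => x)
    rw [Kernel.partialTraj_self, Kernel.id_apply] at h
    have h2 := congrArg (Measure.map (fun y => y ⟨0, Finset.mem_Iic.2 le_rfl⟩)) h
    rw [Measure.map_map (measurable_pi_apply _) (by fun_prop),
      Measure.map_dirac' (measurable_pi_apply _)] at h2
    rw [pow_zero]
    exact h2
  | succ n ih =>
    have h := Kernel.partialTraj_compProd_eq_map_traj (X := fun _ => S × A)
      (κ := M.histStep κ) (a := 0) (b := n) (Nat.zero_le n) (x₀ := fun _ => x)
    have h2 := congrArg Measure.snd h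
    rw [Measure.snd_compProd, Measure.snd, Measure.map_map measurable_snd (by fun_prop)] at h2
    refine h2.symm.trans ?_
    rw [histStep, ← Kernel.comp_deterministic_eq_comap, ← Measure.comp_assoc,
      Measure.deterministic_comp_eq_map, ← Kernel.traj_map_frestrictLe_apply,
      Measure.map_map (measurable_pi_apply _) (by fun_prop), pow_succ']
    change M.step κ ∘ₘ _ = M.step κ ∘ₘ ((M.step κ ^ n) x)
    rw [← ih]
    rfl

theorem integral_trajQ {f : S × A → ℝ} (hf : Measurable f) (x : S × A) (t : ℕ) :
    ∫ ω, f (ω t) ∂(M.trajQ κ x) = ∫ y, f y ∂((M.step κ ^ t) x) := by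
  rw [← map_trajQ, integral_map (measurable_pi_apply t).aemeasurable hf.aestronglyMeasurable]

theorem map_trajV (s : S) (t : ℕ) :
    (M.trajV κ s).map (fun ω => ω t) = (M.step κ ^ t) ∘ₘ ((Kernel.id ×ₖ κ) s) := by
  rw [trajV, Kernel.comp_apply, Measure.map_comp _ _ (measurable_pi_apply t)]
  congr 1
  ext x : 1
  rw [Kernel.map_apply _ (measurable_pi_apply t), map_trajQ]

variable {M κ}

theorem integral_id_prod {f : S × A → ℝ} (hf : Measurable f) (s : S) :
    ∫ x, f x ∂((Kernel.id ×ₖ κ) s) = ∫ a, f (s, a) ∂(κ s) := by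
  rw [Kernel.prod_apply, Kernel.id_apply, Measure.dirac_prod,
    integral_map measurable_prodMk_left.aemeasurable hf.aestronglyMeasurable]

theorem integral_step {E : Type*} [NormedAddCommGroup E] [NormedSpace ℝ E] {f : S × A → E}
    {x : S × A} (hf : Integrable f (M.step κ x)) :
    ∫ y, f y ∂(M.step κ x) = ∫ s, ∫ a, f (s, a) ∂(κ s) ∂(M.P x) := by
  rw [step] at hf ⊢
  exact integral_compProd hf

variable {U : ℝ}

theorem measurable_discountedReturn (hU : ∀ x, |M.R x| ≤ U) :
    Measurable fun ω : ℕ → S × A => ∑' t : ℕ, M.γ ^ t * M.R (ω t) :=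
  measurable_tsum_pow_mul (g := fun t (ω : ℕ → S × A) => M.R (ω t)) M.γ_pos.le M.γ_lt_one
    (fun t => M.measurable_R.comp (measurable_pi_apply t)) (fun t ω => hU (ω t))

theorem abs_discountedReturn_le (hU : ∀ x, |M.R x| ≤ U) (ω : ℕ → S × A) :
    |∑' t : ℕ, M.γ ^ t * M.R (ω t)| ≤ U / (1 - M.γ) :=
  abs_tsum_pow_mul_le M.γ_pos.le M.γ_lt_one fun t => hU (ω t)

theorem measurable_Q (hU : ∀ x, |M.R x| ≤ U) : Measurable (M.Q κ) :=
  (measurable_discountedReturn hU).integral_kernel (M.trajQ κ)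

theorem abs_Q_le (hU : ∀ x, |M.R x| ≤ U) (x : S × A) : |M.Q κ x| ≤ U / (1 - M.γ) :=
  abs_integral_le_of_forall_abs_le (abs_discountedReturn_le hU) _

theorem measurable_V (hU : ∀ x, |M.R x| ≤ U) : Measurable (M.V κ) :=
  (measurable_discountedReturn hU).integral_kernel (M.trajV κ)

theorem abs_V_le (hU : ∀ x, |M.R x| ≤ U) (s : S) : |M.V κ s| ≤ U / (1 - M.γ) :=
  abs_integral_le_of_forall_abs_le (abs_discountedReturn_le hU) _

theorem Q_eq_tsum (hU : ∀ x, |M.R x| ≤ U) (x : S × A) :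
    M.Q κ x = ∑' t : ℕ, M.γ ^ t * ∫ y, M.R y ∂((M.step κ ^ t) x) := by
  rw [Q, integral_tsum_pow_mul (g := fun t (ω : ℕ → S × A) => M.R (ω t)) M.γ_pos.le M.γ_lt_one
    (fun t => M.measurable_R.comp (measurable_pi_apply t)) (fun t ω => hU (ω t))]
  simp_rw [integral_trajQ M κ M.measurable_R]

theorem V_eq_integral_Q (hU : ∀ x, |M.R x| ≤ U) (s : S) : M.V κ s = ∫ a, M.Q κ (s, a) ∂(κ s) := by
  rw [V, trajV, Kernel.integral_comp, ← integral_id_prod (measurable_Q hU)]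
  · rfl
  · exact (measurable_discountedReturn hU).integrable_of_norm_le (abs_discountedReturn_le hU) _

/-- Bellman equation: the `t = 0` term of the series for `Q` is the reward, and the remaining terms
are `γ` times the series averaged over one step of the chain. -/
theorem Q_eq_reward_add (hU : ∀ x, |M.R x| ≤ U) (x : S × A) :
    M.Q κ x = M.R x + M.γ * ∫ s, M.V κ s ∂(M.P x) := by
  have hR : ∀ t x, |∫ y, M.R y ∂((M.step κ ^ t) x)| ≤ U := fun t x =>
    abs_integral_le_of_forall_abs_le hU _
  have hV : ∫ s, M.V κ s ∂(M.P x) = ∫ y, M.Q κ y ∂(M.step κ x) := by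
    rw [integral_step ((measurable_Q hU).integrable_of_norm_le (abs_Q_le hU) _)]
    simp_rw [V_eq_integral_Q hU]
  have hQ : ∫ y, M.Q κ y ∂(M.step κ x)
      = ∑' t : ℕ, M.γ ^ t * ∫ y, M.R y ∂((M.step κ ^ (t + 1)) x) := by
    simp_rw [Q_eq_tsum hU]
    rw [integral_tsum_pow_mul M.γ_pos.le M.γ_lt_one
      (fun t => M.measurable_R.integral_kernel (M.step κ ^ t)) hR]
    refine tsum_congr fun t => ?_
    rw [pow_succ]
    congr 1
    exact (Kernel.integral_comp (κ := M.step κ) (η := M.step κ ^ t)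
      (M.measurable_R.integrable_of_norm_le hU _)).symm
  rw [hV, hQ, Q_eq_tsum hU, (summable_pow_mul_of_abs_le M.γ_pos.le M.γ_lt_one
    fun t => hR t x).tsum_eq_zero_add, ← tsum_mul_left]
  congr 1
  · rw [pow_zero, pow_zero, one_mul]
    change ∫ y, M.R y ∂(Kernel.id x) = _
    rw [Kernel.id_apply, integral_dirac' _ _ M.measurable_R.stronglyMeasurable]
  · simp_rw [pow_succ' M.γ, mul_assoc]

end MDP

/-! ### The occupancy measure: sampling, stationarity, disintegration -/

namespace MDP

variable {S A : Type*} [MeasurableSpace S] [MeasurableSpace A] (M : MDP S A) (κ : Kernel S A)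
  [IsMarkovKernel κ]

theorem sqrt_γ_lt_one : √M.γ < 1 := by
  rw [Real.sqrt_lt' one_pos, one_pow]
  exact M.γ_lt_one

theorem outerHorizon_eq_sum : M.outerHorizon =
    Measure.sum fun t : ℕ => ENNReal.ofReal ((1 - M.γ) * M.γ ^ t) • Measure.dirac t := by
  rw [outerHorizon, geometricMeasure_eq]
  · simp only [sub_sub_cancel, mul_comm]
  · intro h
    have := congrArg Subtype.val h
    have h1 := M.γ_lt_one
    simp only [Set.Icc.coe_zero] at this
    linarith

/-- The probabilities of the independent outer horizon are exactly the weights `(1 - γ) γ ^ t` of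
the time marginals. -/
theorem map_lastPair_outerSample (s₀ : S) :
    (M.outerSample κ s₀).map lastPair = M.occupancy κ s₀ := by
  rw [outerSample, outerHorizon_eq_sum, Measure.prod_sum_left,
    Measure.map_sum measurable_lastPair.aemeasurable, occupancy]
  congr 1
  funext t
  rw [Measure.prod_smul_left, Measure.map_smul, Measure.dirac_prod,
    Measure.map_map measurable_lastPair measurable_prodMk_left]
  rfl

instance (s₀ : S) : IsProbabilityMeasure (M.outerSample κ s₀) := by
  unfold outerSample; infer_instance

instance (s₀ : S) : IsProbabilityMeasure (M.occupancy κ s₀) := by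
  rw [← map_lastPair_outerSample]
  exact Measure.isProbabilityMeasure_map measurable_lastPair.aemeasurable

theorem step_eq_comp : M.step κ = (Kernel.id ×ₖ κ) ∘ₖ M.P :=
  Kernel.compProd_prodMkLeft_eq_comp _ _

/-- The occupancy measure is stationary for the chain restarted with probability `1 - γ`. -/
theorem occupancy_eq_add (s₀ : S) : M.occupancy κ s₀ =
    ENNReal.ofReal (1 - M.γ) • (Kernel.id ×ₖ κ) s₀ +
      ENNReal.ofReal M.γ • (M.step κ ∘ₘ M.occupancy κ s₀) := by
  simp_rw [occupancy, map_trajV]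
  rw [Measure.bind_sum _ _ (M.step κ).measurable.aemeasurable]
  simp_rw [Measure.bind_smul, Measure.comp_assoc]
  ext s hs
  -- The `t = 0` term is the restart; shifting the index in the others factors out one `γ` and one
  -- `step`.
  rw [Measure.add_apply, Measure.smul_apply, Measure.smul_apply, Measure.sum_apply _ hs,
    Measure.sum_apply _ hs, tsum_eq_zero_add' ENNReal.summable]
  congr 1
  · rw [pow_zero, mul_one, pow_zero, Measure.smul_apply]
    congr 2
    exact Measure.id_comp
  · rw [smul_eq_mul, ← ENNReal.tsum_mul_left]
    refine tsum_congr fun t => ?_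
    rw [Measure.smul_apply, Measure.smul_apply, smul_eq_mul, smul_eq_mul, ← mul_assoc,
      ← ENNReal.ofReal_mul M.γ_pos.le, pow_succ', pow_succ' (M.step κ), mul_left_comm]
    rfl

/-- Both terms of `occupancy_eq_add` end with a draw of the action from `κ` at the current state,
since `step` is `P` followed by such a draw. Removing that draw leaves the state measure `m`. -/
theorem exists_occupancy_eq_compProd (s₀ : S) :
    ∃ m : Measure S, IsFiniteMeasure m ∧ M.occupancy κ s₀ = m ⊗ₘ κ := by
  refine ⟨ENNReal.ofReal (1 - M.γ) • Measure.dirac s₀ +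
    ENNReal.ofReal M.γ • (M.P ∘ₘ M.occupancy κ s₀), ?_, ?_⟩
  · have := Measure.smul_finite (Measure.dirac s₀) (c := ENNReal.ofReal (1 - M.γ))
      ENNReal.ofReal_ne_top
    have := Measure.smul_finite (M.P ∘ₘ M.occupancy κ s₀) (c := ENNReal.ofReal M.γ)
      ENNReal.ofReal_ne_top
    infer_instance
  · conv_lhs => rw [occupancy_eq_add, step_eq_comp, ← Measure.comp_assoc]
    have := Measure.smul_finite (Measure.dirac s₀) (c := ENNReal.ofReal (1 - M.γ))
      ENNReal.ofReal_ne_top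
    have := Measure.smul_finite (M.P ∘ₘ M.occupancy κ s₀) (c := ENNReal.ofReal M.γ)
      ENNReal.ofReal_ne_top
    rw [Measure.compProd_eq_comp_prod, Measure.comp_add, Measure.comp_smul, Measure.comp_smul,
      Measure.dirac_bind (Kernel.measurable _)]

variable {M κ}

/-- Actions are conditionally distributed according to the policy under the occupancy measure. -/
theorem integral_occupancy_eq_integral_integral {E : Type*} [NormedAddCommGroup E]
    [NormedSpace ℝ E] [CompleteSpace E] [MeasurableSpace E] [BorelSpace E]
    [SecondCountableTopology E]
    {f : S × A → E} (hf : Measurable f) {C : ℝ} (hC : ∀ x, ‖f x‖ ≤ C) (s₀ : S) :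
    ∫ x, f x ∂(M.occupancy κ s₀)
      = ∫ x : S × A, ∫ a, f (x.1, a) ∂(κ x.1) ∂(M.occupancy κ s₀) := by
  obtain ⟨m, _, hm⟩ := M.exists_occupancy_eq_compProd κ s₀
  have hg : Measurable fun s => ∫ a, f (s, a) ∂(κ s) :=
    (hf.stronglyMeasurable.integral_kernel_prod_right' (κ := κ)).measurable
  rw [hm, Measure.integral_compProd (hf.integrable_of_norm_le hC _),
    Measure.integral_compProd (f := fun x => ∫ a, f (x.1, a) ∂(κ x.1))
      ((hg.comp measurable_fst).integrable_of_norm_le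
        (fun x => norm_integral_le_of_forall_norm_le (fun a => hC _) _) _)]
  simp

theorem integral_occupancy_eq_add {f : S × A → ℝ} (hf : Measurable f) {C : ℝ}
    (hC : ∀ x, |f x| ≤ C) (s₀ : S) :
    ∫ x, f x ∂(M.occupancy κ s₀) = (1 - M.γ) * ∫ a, f (s₀, a) ∂(κ s₀) +
      M.γ * ∫ x, ∫ y, f y ∂(M.step κ x) ∂(M.occupancy κ s₀) := by
  have hi : ∀ (μ : Measure (S × A)) [IsFiniteMeasure μ], Integrable f μ := fun μ _ =>
    hf.integrable_of_norm_le hC μ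
  conv_lhs => rw [occupancy_eq_add]
  rw [integral_add_measure ((hi _).smul_measure ENNReal.ofReal_ne_top)
      ((hi _).smul_measure ENNReal.ofReal_ne_top), integral_smul_measure, integral_smul_measure,
    ENNReal.toReal_ofReal (sub_nonneg.2 M.γ_lt_one.le), ENNReal.toReal_ofReal M.γ_pos.le,
    integral_id_prod hf, Measure.comp_eq_comp_const_apply,
    Kernel.integral_comp (hi _)]
  rfl

end MDP

/-- A quadratic first-order expansion determines the gradient. -/
theorem hasGradientAt_of_abs_sub_le {E : Type*} [NormedAddCommGroup E] [InnerProductSpace ℝ E]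
    [CompleteSpace E] {f : E → ℝ} {g θ : E} {C r : ℝ} (hr : 0 < r)
    (h : ∀ θ', ‖θ' - θ‖ ≤ r → |f θ' - f θ - inner ℝ g (θ' - θ)| ≤ C * ‖θ' - θ‖ ^ 2) :
    HasGradientAt f g θ := by
  rw [hasGradientAt_iff_hasFDerivAt, hasFDerivAt_iff_isLittleO]
  refine Asymptotics.IsBigO.trans_isLittleO (g := fun θ' => ‖θ' - θ‖ ^ 2) ?_ ?_
  · refine Asymptotics.IsBigO.of_bound C ?_
    filter_upwards [Metric.closedBall_mem_nhds θ hr] with θ' hθ'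
    rw [mem_closedBall_iff_norm] at hθ'
    simpa [Real.norm_eq_abs] using h θ' hθ'
  · rw [← Asymptotics.isLittleO_norm_right]
    simp_rw [pow_two]
    refine (Asymptotics.isLittleO_one_iff ℝ).2 ?_ |>.mul_isBigO
      (Asymptotics.isBigO_refl (fun θ' => ‖θ' - θ‖) _) |>.congr_right fun _ => one_mul _
    have : Continuous fun θ' : E => ‖θ' - θ‖ := by fun_prop
    simpa using this.tendsto θ

/-! ### Performance difference -/

namespace MDP

variable {S A : Type*} [MeasurableSpace S] [MeasurableSpace A] {M : MDP S A} {κ κ' : Kernel S A}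
  [IsMarkovKernel κ] [IsMarkovKernel κ'] {U : ℝ}

/-- The value of one policy, as an integral against the occupancy measure of another one. -/
theorem mul_V_eq_integral_occupancy (hU : ∀ x, |M.R x| ≤ U) (s₀ : S) :
    (1 - M.γ) * M.V κ' s₀ =
      ∫ x, M.V κ' x.1 ∂(M.occupancy κ s₀) - ∫ x, M.Q κ' x ∂(M.occupancy κ s₀) +
        ∫ x, M.R x ∂(M.occupancy κ s₀) := by
  have hVm : Measurable fun x : S × A => M.V κ' x.1 := (measurable_V hU).comp measurable_fst
  have hV : ∀ (μ : Measure (S × A)) [IsFiniteMeasure μ], Integrable (fun x => M.V κ' x.1) μ :=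
    fun μ _ => hVm.integrable_of_norm_le (fun x => abs_V_le hU x.1) μ
  have hQ : Integrable (M.Q κ') (M.occupancy κ s₀) :=
    (measurable_Q hU).integrable_of_norm_le (abs_Q_le hU) _
  have hR := M.measurable_R.integrable_of_norm_le hU (M.occupancy κ s₀)
  -- For a function of the state alone, the restart term is its value at `s₀`; the one-step term
  -- becomes `Q - R` by the Bellman equation for `κ'`.
  have h := integral_occupancy_eq_add (M := M) (κ := κ) hVm (fun x => abs_V_le hU x.1) s₀
  have hstep : ∀ x, M.γ * ∫ y, M.V κ' y.1 ∂(M.step κ x) = M.Q κ' x - M.R x := fun x => by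
    rw [integral_step (hV _), Q_eq_reward_add hU x]
    simp
  rw [← integral_const_mul M.γ, integral_congr_ae (ae_of_all _ hstep), integral_sub hQ hR] at h
  rw [h]
  simp only [integral_const, probReal_univ, one_smul]
  ring

/-- The performance difference identity. -/
theorem mul_V_sub_V_eq_integral (hU : ∀ x, |M.R x| ≤ U) (s₀ : S) :
    (1 - M.γ) * (M.V κ' s₀ - M.V κ s₀) =
      ∫ x : S × A, (∫ a, M.Q κ' (x.1, a) ∂(κ' x.1) - ∫ a, M.Q κ' (x.1, a) ∂(κ x.1))
        ∂(M.occupancy κ s₀) := by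
  have hV : ∀ (κ₁ : Kernel S A) [IsMarkovKernel κ₁],
      Integrable (fun x : S × A => M.V κ₁ x.1) (M.occupancy κ s₀) := fun κ₁ _ =>
    ((measurable_V hU).comp measurable_fst).integrable_of_norm_le (fun x => abs_V_le hU x.1) _
  have hI : Integrable (fun x : S × A => ∫ a, M.Q κ' (x.1, a) ∂(κ x.1)) (M.occupancy κ s₀) :=
    (((measurable_Q hU).stronglyMeasurable.integral_kernel_prod_right' (κ := κ)).measurable.comp
      measurable_fst).integrable_of_norm_le
        (fun x => norm_integral_le_of_forall_norm_le (fun a => abs_Q_le hU _) _) _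
  -- In the identity for `κ` itself, the integrals of `V` and `Q` cancel after averaging over
  -- actions, leaving the reward integral, which is common to both identities.
  rw [mul_sub, mul_V_eq_integral_occupancy (κ := κ) (κ' := κ') hU,
    mul_V_eq_integral_occupancy (κ := κ) (κ' := κ) hU,
    integral_occupancy_eq_integral_integral (f := M.Q κ) (measurable_Q hU) (abs_Q_le hU),
    integral_occupancy_eq_integral_integral (f := M.Q κ') (measurable_Q hU) (abs_Q_le hU)]
  simp_rw [← V_eq_integral_Q hU (κ := κ), ← V_eq_integral_Q hU (κ := κ')]
  rw [integral_sub (hV _) hI]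
  ring

end MDP

/-! ### Likelihood ratios -/

namespace ParamPolicy

variable {d : ℕ} {S A : Type*} [MeasurableSpace S] [MeasurableSpace A] {ν : Measure A}

/-- The likelihood ratio `π_θ'(a | s) / π_θ(a | s)` at the pair `x = (s, a)`. -/
noncomputable def ratio (π : ParamPolicy d S ν) (θ θ' : EuclideanSpace ℝ (Fin d)) (x : S × A) : ℝ :=
  π.dens θ' x.1 x.2 / π.dens θ x.1 x.2

theorem measurable_ratio (π : ParamPolicy d S ν) (θ θ' : EuclideanSpace ℝ (Fin d)) :
    Measurable (π.ratio θ θ') :=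
  (π.measurable_dens θ').div (π.measurable_dens θ)

theorem integral_kernel [SigmaFinite ν] (π : ParamPolicy d S ν) (θ : EuclideanSpace ℝ (Fin d))
    (s : S) (f : A → ℝ) : ∫ a, f a ∂(π.kernel θ s) = ∫ a, π.dens θ s a * f a ∂ν := by
  have hd : Measurable (π.dens θ s) := (π.measurable_dens θ).comp measurable_prodMk_left
  rw [kernel, Kernel.withDensity_apply _ (π.measurable_dens θ).ennreal_ofReal, Kernel.const_apply,
    integral_withDensity_eq_integral_toReal_smul hd.ennreal_ofReal (by simp)]
  simp_rw [ENNReal.toReal_ofReal (π.dens_nonneg θ s _), smul_eq_mul]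

theorem integral_ratio_mul [SigmaFinite ν] (π : ParamPolicy d S ν)
    {θ θ' : EuclideanSpace ℝ (Fin d)} (hpos : ∀ s a, 0 < π.dens θ s a) (s : S) (f : A → ℝ) :
    ∫ a, π.ratio θ θ' (s, a) * f a ∂(π.kernel θ s) = ∫ a, f a ∂(π.kernel θ' s) := by
  rw [integral_kernel, integral_kernel]
  refine integral_congr_ae (ae_of_all _ fun a => ?_)
  have := (hpos s a).ne'
  simp only [ratio]
  field_simp

end ParamPolicy

/-! ### Uniform expansions of the log-density and of the likelihood ratio -/

namespace MDP.Regular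

variable {d : ℕ} {S A : Type*} [MeasurableSpace S] [MeasurableSpace A] {ν : Measure A}
  {M : MDP S A} {π : ParamPolicy d S ν} {U_R L_Θ B_Θ : ℝ}

theorem differentiableAt_log (h : M.Regular π U_R L_Θ B_Θ) (θ : EuclideanSpace ℝ (Fin d))
    (x : S × A) : DifferentiableAt ℝ (fun θ' => Real.log (π.dens θ' x.1 x.2)) θ :=
  (h.differentiable x.1 x.2 θ).log (h.dens_pos θ x.1 x.2).ne'

theorem hasFDerivAt_log (h : M.Regular π U_R L_Θ B_Θ) (θ : EuclideanSpace ℝ (Fin d))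
    (x : S × A) : HasFDerivAt (fun θ' => Real.log (π.dens θ' x.1 x.2))
      (InnerProductSpace.toDual ℝ _ (π.score θ x)) θ :=
  (h.differentiableAt_log θ x).hasGradientAt.hasFDerivAt

/-- Each coordinate is a pointwise limit of difference quotients with step `1 / (n + 1)`, which are
measurable in `(s, a)`. -/
theorem measurable_score (h : M.Regular π U_R L_Θ B_Θ) (θ : EuclideanSpace ℝ (Fin d)) :
    Measurable (π.score θ) := by
  have hcoord : ∀ i, Measurable fun x => π.score θ x i := fun i => by
    set e : EuclideanSpace ℝ (Fin d) := EuclideanSpace.single i 1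
    have hlog : ∀ θ, Measurable fun x : S × A => Real.log (π.dens θ x.1 x.2) := fun θ =>
      (π.measurable_dens θ).log
    refine measurable_of_tendsto_metrizable
      (f := fun (n : ℕ) x => (n + 1 : ℝ) * (Real.log (π.dens (θ + (n + 1 : ℝ)⁻¹ • e) x.1 x.2) -
        Real.log (π.dens θ x.1 x.2))) (fun n => ((hlog _).sub (hlog _)).const_mul _) ?_
    refine tendsto_pi_nhds.2 fun x => ?_
    have h1 := (h.hasFDerivAt_log θ x).lim_real e
    have h2 := h1.comp (Filter.tendsto_atTop_add_const_right _ (1 : ℝ)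
      tendsto_natCast_atTop_atTop)
    simpa [e, Function.comp_def, EuclideanSpace.inner_single_right] using h2
  exact (MeasurableEquiv.toLp 2 (Fin d → ℝ)).measurable.comp
    (measurable_pi_lambda _ hcoord)

theorem ratio_eq_exp (h : M.Regular π U_R L_Θ B_Θ) (θ θ' : EuclideanSpace ℝ (Fin d)) (x : S × A) :
    π.ratio θ θ' x = Real.exp (Real.log (π.dens θ' x.1 x.2) - Real.log (π.dens θ x.1 x.2)) := by
  rw [Real.exp_sub, Real.exp_log (h.dens_pos _ _ _), Real.exp_log (h.dens_pos _ _ _)]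
  rfl

theorem abs_log_sub_log_le (h : M.Regular π U_R L_Θ B_Θ) (θ θ' : EuclideanSpace ℝ (Fin d))
    (x : S × A) : |Real.log (π.dens θ' x.1 x.2) - Real.log (π.dens θ x.1 x.2)|
      ≤ B_Θ * ‖θ' - θ‖ := by
  refine Convex.norm_image_sub_le_of_norm_hasFDerivWithin_le (s := Set.univ)
    (f := fun θ' => Real.log (π.dens θ' x.1 x.2))
    (fun y _ => (h.hasFDerivAt_log y x).hasFDerivWithinAt) (fun y _ => ?_) convex_univ
    (Set.mem_univ _) (Set.mem_univ _)
  rw [LinearIsometryEquiv.norm_map]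
  exact h.score_bound y x.1 x.2

/-- Mean value inequality for the log-density minus its linear part, on the ball around `θ` reaching
`θ'`, where the Lipschitz condition controls the derivative. The absolute value is there because
`L_Θ` carries no sign condition. -/
theorem abs_log_sub_log_sub_inner_le (h : M.Regular π U_R L_Θ B_Θ)
    (θ θ' : EuclideanSpace ℝ (Fin d)) (x : S × A) :
    |Real.log (π.dens θ' x.1 x.2) - Real.log (π.dens θ x.1 x.2)
      - inner ℝ (π.score θ x) (θ' - θ)| ≤ |L_Θ| * ‖θ' - θ‖ ^ 2 := by
  rw [pow_two, ← mul_assoc]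
  refine Convex.norm_image_sub_le_of_norm_hasFDerivWithin_le'
    (s := Metric.closedBall θ ‖θ' - θ‖)
    (f := fun θ' => Real.log (π.dens θ' x.1 x.2))
    (φ := InnerProductSpace.toDual ℝ _ (π.score θ x))
    (fun y _ => (h.hasFDerivAt_log y x).hasFDerivWithinAt) (fun y hy => ?_)
    (convex_closedBall _ _) (Metric.mem_closedBall_self (norm_nonneg _))
    (mem_closedBall_iff_norm.2 le_rfl)
  rw [← map_sub, LinearIsometryEquiv.norm_map]
  refine (h.score_lipschitz y θ x.1 x.2).trans ?_
  exact mul_le_mul (le_abs_self _) (mem_closedBall_iff_norm.1 hy) (norm_nonneg _) (abs_nonneg _)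

/-- The radius `B_Θ⁻¹` keeps the log-ratio `u` in `[-1, 1]`, where `|exp u - 1| ≤ 2|u|` and, for the
next lemma, `|exp u - 1 - u| ≤ u²`. -/
theorem abs_ratio_sub_one_le (h : M.Regular π U_R L_Θ B_Θ) {θ θ' : EuclideanSpace ℝ (Fin d)}
    (hθ : ‖θ' - θ‖ ≤ B_Θ⁻¹) (x : S × A) : |π.ratio θ θ' x - 1| ≤ 2 * B_Θ * ‖θ' - θ‖ := by
  have h1 := h.abs_log_sub_log_le θ θ' x
  have h2 : B_Θ * ‖θ' - θ‖ ≤ 1 := by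
    simpa [h.B_pos.ne'] using mul_le_mul_of_nonneg_left hθ h.B_pos.le
  rw [h.ratio_eq_exp]
  refine (Real.abs_exp_sub_one_le (h1.trans h2)).trans ?_
  linarith

theorem abs_ratio_sub_one_sub_inner_le (h : M.Regular π U_R L_Θ B_Θ)
    {θ θ' : EuclideanSpace ℝ (Fin d)} (hθ : ‖θ' - θ‖ ≤ B_Θ⁻¹) (x : S × A) :
    |π.ratio θ θ' x - 1 - inner ℝ (π.score θ x) (θ' - θ)|
      ≤ (|L_Θ| + B_Θ ^ 2) * ‖θ' - θ‖ ^ 2 := by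
  have h1 := h.abs_log_sub_log_le θ θ' x
  have h2 : B_Θ * ‖θ' - θ‖ ≤ 1 := by
    simpa [h.B_pos.ne'] using mul_le_mul_of_nonneg_left hθ h.B_pos.le
  have h3 := h.abs_log_sub_log_sub_inner_le θ θ' x
  rw [h.ratio_eq_exp]
  set u := Real.log (π.dens θ' x.1 x.2) - Real.log (π.dens θ x.1 x.2)
  have h4 := Real.abs_exp_sub_one_sub_id_le (h1.trans h2)
  have h5 : u ^ 2 ≤ (B_Θ * ‖θ' - θ‖) ^ 2 := sq_le_sq' (by linarith [neg_abs_le u]) (le_of_abs_le h1)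
  have h6 := abs_add_le (Real.exp u - 1 - u) (u - inner ℝ (π.score θ x) (θ' - θ))
  have h7 : Real.exp u - 1 - u + (u - inner ℝ (π.score θ x) (θ' - θ))
      = Real.exp u - 1 - inner ℝ (π.score θ x) (θ' - θ) := by ring
  rw [h7] at h6
  nlinarith

end MDP.Regular

/-! ### The policy gradient theorem -/

namespace MDP.Regular

variable {d : ℕ} {S A : Type*} [MeasurableSpace S] [MeasurableSpace A] {ν : Measure A}
  {M : MDP S A} {π : ParamPolicy d S ν} {U_R L_Θ B_Θ : ℝ}

theorem abs_reward_le (h : M.Regular π U_R L_Θ B_Θ) (x : S × A) : |M.R x| ≤ U_R :=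
  h.reward_bound x.1 x.2

theorem norm_score_le (h : M.Regular π U_R L_Θ B_Θ) (θ : EuclideanSpace ℝ (Fin d)) (x : S × A) :
    ‖π.score θ x‖ ≤ B_Θ :=
  h.score_bound θ x.1 x.2

theorem abs_inner_score_le (h : M.Regular π U_R L_Θ B_Θ) (θ v : EuclideanSpace ℝ (Fin d))
    (x : S × A) : |inner ℝ (π.score θ x) v| ≤ B_Θ * ‖v‖ :=
  (abs_real_inner_le_norm _ _).trans
    (mul_le_mul_of_nonneg_right (h.norm_score_le θ x) (norm_nonneg v))

theorem norm_mul_smul_score_le (h : M.Regular π U_R L_Θ B_Θ) (θ : EuclideanSpace ℝ (Fin d))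
    {c C : ℝ} (hc : |c| ≤ C) (x : S × A) : ‖c • π.score θ x‖ ≤ C * B_Θ := by
  rw [norm_smul, Real.norm_eq_abs]
  exact mul_le_mul hc (h.norm_score_le θ x) (norm_nonneg _) ((abs_nonneg c).trans hc)

variable [SigmaFinite ν]

/-- The score has mean zero under the policy. -/
theorem integral_score_eq_zero (h : M.Regular π U_R L_Θ B_Θ) (θ : EuclideanSpace ℝ (Fin d))
    (s : S) : ∫ a, π.score θ (s, a) ∂(π.kernel θ s) = 0 := by
  have hm : Measurable fun a => π.score θ (s, a) :=
    (h.measurable_score θ).comp measurable_prodMk_left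
  have hi : Integrable (fun a => π.score θ (s, a)) (π.kernel θ s) :=
    hm.integrable_of_norm_le (fun a => h.norm_score_le θ (s, a)) _
  -- The mean of `ratio - 1` under `π_θ` vanishes for every `θ'`. Integrating the expansion of the
  -- ratio makes the mean score a gradient of this zero function, so it is zero by uniqueness.
  have hg : HasGradientAt (fun _ : EuclideanSpace ℝ (Fin d) => (0 : ℝ))
      (∫ a, π.score θ (s, a) ∂(π.kernel θ s)) θ := by
    refine hasGradientAt_of_abs_sub_le (C := |L_Θ| + B_Θ ^ 2) (inv_pos.2 h.B_pos) fun θ' hθ' => ?_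
    have hr : Integrable (fun a => π.ratio θ θ' (s, a) - 1) (π.kernel θ s) :=
      (((π.measurable_ratio θ θ').comp measurable_prodMk_left).sub_const 1).integrable_of_norm_le
        (fun a => h.abs_ratio_sub_one_le hθ' (s, a)) _
    have hr1 : ∫ a, (π.ratio θ θ' (s, a) - 1) ∂(π.kernel θ s) = 0 := by
      have hr' : Integrable (fun a => π.ratio θ θ' (s, a)) (π.kernel θ s) :=
        (hr.add (integrable_const 1)).congr (ae_of_all _ fun a => sub_add_cancel _ _)
      have h1 := π.integral_ratio_mul (θ := θ) (θ' := θ') (h.dens_pos θ) s fun _ => 1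
      simp only [mul_one] at h1
      rw [integral_sub hr' (integrable_const 1), h1]
      simp
    have hint : ∫ a, (π.ratio θ θ' (s, a) - 1 - inner ℝ (π.score θ (s, a)) (θ' - θ))
        ∂(π.kernel θ s) = 0 - 0 - inner ℝ (∫ a, π.score θ (s, a) ∂(π.kernel θ s)) (θ' - θ) := by
      rw [integral_sub hr (hi.inner_const _), hr1, sub_self, real_inner_comm, ← integral_inner hi]
      simp_rw [real_inner_comm]
    rw [← hint]
    exact abs_integral_le_of_forall_abs_le
      (fun a => h.abs_ratio_sub_one_sub_inner_le hθ' (s, a)) _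
  exact hg.unique (hasGradientAt_const θ (0 : ℝ))

theorem mul_V_sub_V_eq_integral_ratio (h : M.Regular π U_R L_Θ B_Θ)
    {θ θ' : EuclideanSpace ℝ (Fin d)} (hθ : ‖θ' - θ‖ ≤ B_Θ⁻¹) (s : S) :
    (1 - M.γ) * (M.V (π.kernel θ') s - M.V (π.kernel θ) s) =
      ∫ x, (π.ratio θ θ' x - 1) * M.Q (π.kernel θ') x ∂(M.occupancy (π.kernel θ) s) := by
  have hQm := measurable_Q (κ := π.kernel θ') h.abs_reward_le
  have hb : ∀ x, ‖(π.ratio θ θ' x - 1) * M.Q (π.kernel θ') x‖ ≤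
      2 * B_Θ * ‖θ' - θ‖ * (U_R / (1 - M.γ)) := fun x => by
    rw [norm_mul]
    have h1 := h.abs_ratio_sub_one_le hθ x
    exact mul_le_mul h1 (abs_Q_le h.abs_reward_le x) (norm_nonneg _) ((abs_nonneg _).trans h1)
  have hm : Measurable fun x => (π.ratio θ θ' x - 1) * M.Q (π.kernel θ') x :=
    ((π.measurable_ratio θ θ').sub_const 1).mul hQm
  rw [mul_V_sub_V_eq_integral h.abs_reward_le, integral_occupancy_eq_integral_integral hm hb]
  refine integral_congr_ae (ae_of_all _ fun x => ?_)
  have hQi : Integrable (fun a => M.Q (π.kernel θ') (x.1, a)) (π.kernel θ x.1) :=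
    (hQm.comp measurable_prodMk_left).integrable_of_norm_le
      (fun a => abs_Q_le h.abs_reward_le (x.1, a)) _
  have hi : Integrable (fun a => (π.ratio θ θ' (x.1, a) - 1) * M.Q (π.kernel θ') (x.1, a))
      (π.kernel θ x.1) :=
    (hm.comp measurable_prodMk_left).integrable_of_norm_le (fun a => hb (x.1, a)) _
  simp only
  rw [← π.integral_ratio_mul (θ := θ) (h.dens_pos θ), sub_eq_iff_eq_add, ← integral_add hi hQi]
  refine integral_congr_ae (ae_of_all _ fun a => ?_)
  simp only
  ring

theorem abs_V_sub_V_le (h : M.Regular π U_R L_Θ B_Θ)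
    {θ θ' : EuclideanSpace ℝ (Fin d)} (hθ : ‖θ' - θ‖ ≤ B_Θ⁻¹) (s : S) :
    |M.V (π.kernel θ') s - M.V (π.kernel θ) s| ≤
      2 * B_Θ * ‖θ' - θ‖ * (U_R / (1 - M.γ)) / (1 - M.γ) := by
  have hγ := sub_pos.2 M.γ_lt_one
  rw [le_div_iff₀ hγ, mul_comm, ← abs_of_pos hγ, ← abs_mul, abs_of_pos hγ,
    h.mul_V_sub_V_eq_integral_ratio hθ]
  refine abs_integral_le_of_forall_abs_le (fun x => ?_) _
  rw [abs_mul]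
  have h1 := h.abs_ratio_sub_one_le hθ x
  exact mul_le_mul h1 (abs_Q_le h.abs_reward_le x) (abs_nonneg _) ((abs_nonneg _).trans h1)

/-- By Bellman, `Q` depends on the policy only through `V` at the next state, so the bound for `V`
carries over; the extra factor `γ < 1` is dropped. -/
theorem abs_Q_sub_Q_le (h : M.Regular π U_R L_Θ B_Θ)
    {θ θ' : EuclideanSpace ℝ (Fin d)} (hθ : ‖θ' - θ‖ ≤ B_Θ⁻¹) (x : S × A) :
    |M.Q (π.kernel θ') x - M.Q (π.kernel θ) x| ≤
      2 * B_Θ * ‖θ' - θ‖ * (U_R / (1 - M.γ)) / (1 - M.γ) := by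
  have hV : ∀ θ, Integrable (M.V (π.kernel θ)) (M.P x) := fun θ =>
    (measurable_V h.abs_reward_le).integrable_of_norm_le (abs_V_le h.abs_reward_le) _
  rw [Q_eq_reward_add h.abs_reward_le, Q_eq_reward_add h.abs_reward_le, add_sub_add_left_eq_sub,
    ← mul_sub, ← integral_sub (hV θ') (hV θ), abs_mul, abs_of_pos M.γ_pos]
  have h1 := abs_integral_le_of_forall_abs_le (h.abs_V_sub_V_le hθ) (M.P x)
  exact (mul_le_of_le_one_left (abs_nonneg _) M.γ_lt_one.le).trans h1

theorem measurable_Q_smul_score (h : M.Regular π U_R L_Θ B_Θ) (θ : EuclideanSpace ℝ (Fin d)) :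
    Measurable fun x => M.Q (π.kernel θ) x • π.score θ x :=
  (measurable_Q h.abs_reward_le).smul (h.measurable_score θ)

theorem norm_Q_smul_score_le (h : M.Regular π U_R L_Θ B_Θ) (θ : EuclideanSpace ℝ (Fin d))
    (x : S × A) : ‖M.Q (π.kernel θ) x • π.score θ x‖ ≤ U_R / (1 - M.γ) * B_Θ :=
  h.norm_mul_smul_score_le θ (abs_Q_le h.abs_reward_le x) x

theorem integrable_Q_smul_score (h : M.Regular π U_R L_Θ B_Θ) (θ : EuclideanSpace ℝ (Fin d))
    (s₀ : S) : Integrable (fun x => M.Q (π.kernel θ) x • π.score θ x)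
      (M.occupancy (π.kernel θ) s₀) :=
  (h.measurable_Q_smul_score θ).integrable_of_norm_le (h.norm_Q_smul_score_le θ) _

/-- The policy gradient theorem. -/
theorem hasGradientAt_J (h : M.Regular π U_R L_Θ B_Θ) (s₀ : S) (θ : EuclideanSpace ℝ (Fin d)) :
    HasGradientAt (M.J π s₀) ((1 / (1 - M.γ)) •
      ∫ x, M.Q (π.kernel θ) x • π.score θ x ∂(M.occupancy (π.kernel θ) s₀)) θ := by
  have hγ := sub_pos.2 M.γ_lt_one
  set W := U_R / (1 - M.γ)
  refine hasGradientAt_of_abs_sub_le (r := B_Θ⁻¹)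
    -- `W` bounds `|Q|`. The first summand is the quadratic error of the ratio times `Q_θ'`; the
    -- second is the linear term, at most `B_Θ ‖θ' - θ‖`, times the Lipschitz bound on `Q_θ' - Q_θ`.
    -- The outer division undoes the factor `1 - γ` in the performance difference.
    (C := ((|L_Θ| + B_Θ ^ 2) * W + B_Θ * (2 * B_Θ * W / (1 - M.γ))) / (1 - M.γ))
    (inv_pos.2 h.B_pos) fun θ' hθ' => ?_
  set ρ := M.occupancy (π.kernel θ) s₀
  have hi := h.integrable_Q_smul_score θ s₀
  have hr : Integrable (fun x => (π.ratio θ θ' x - 1) * M.Q (π.kernel θ') x) ρ := by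
    refine (((π.measurable_ratio θ θ').sub_const 1).mul
      (measurable_Q h.abs_reward_le)).integrable_of_norm_le
        (C := 2 * B_Θ * ‖θ' - θ‖ * W) (fun x => ?_) _
    have h1 := h.abs_ratio_sub_one_le hθ' x
    exact (norm_mul _ _).trans_le (mul_le_mul h1 (abs_Q_le h.abs_reward_le x) (norm_nonneg _)
      ((abs_nonneg _).trans h1))
  have hkey : (1 - M.γ) * (M.J π s₀ θ' - M.J π s₀ θ - inner ℝ ((1 / (1 - M.γ)) •
      ∫ x, M.Q (π.kernel θ) x • π.score θ x ∂ρ) (θ' - θ)) =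
      ∫ x, ((π.ratio θ θ' x - 1) * M.Q (π.kernel θ') x -
        inner ℝ (θ' - θ) (M.Q (π.kernel θ) x • π.score θ x)) ∂ρ := by
    rw [integral_sub hr (hi.const_inner _), integral_inner hi,
      ← h.mul_V_sub_V_eq_integral_ratio hθ', real_inner_smul_left,
      real_inner_comm (θ' - θ), mul_sub (1 - M.γ) (_ - _), ← mul_assoc, mul_one_div_cancel hγ.ne',
      one_mul]
    rfl
  rw [div_mul_eq_mul_div, le_div_iff₀ hγ, mul_comm |_|, ← abs_of_pos hγ, ← abs_mul, abs_of_pos hγ,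
    hkey]
  refine abs_integral_le_of_forall_abs_le (fun x => ?_) _
  rw [real_inner_smul_right, real_inner_comm]
  have hsplit : (π.ratio θ θ' x - 1) * M.Q (π.kernel θ') x -
      M.Q (π.kernel θ) x * inner ℝ (π.score θ x) (θ' - θ) =
      (π.ratio θ θ' x - 1 - inner ℝ (π.score θ x) (θ' - θ)) * M.Q (π.kernel θ') x +
        inner ℝ (π.score θ x) (θ' - θ) * (M.Q (π.kernel θ') x - M.Q (π.kernel θ) x) := by ring
  rw [hsplit]
  refine (abs_add_le _ _).trans ?_
  rw [abs_mul, abs_mul]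
  have h1 := h.abs_ratio_sub_one_sub_inner_le hθ' x
  have h2 := h.abs_inner_score_le θ (θ' - θ) x
  calc _ ≤ (|L_Θ| + B_Θ ^ 2) * ‖θ' - θ‖ ^ 2 * W +
        B_Θ * ‖θ' - θ‖ * (2 * B_Θ * ‖θ' - θ‖ * W / (1 - M.γ)) :=
      add_le_add (mul_le_mul h1 (abs_Q_le h.abs_reward_le x) (abs_nonneg _)
        ((abs_nonneg _).trans h1)) (mul_le_mul h2 (h.abs_Q_sub_Q_le hθ' x) (abs_nonneg _)
        ((abs_nonneg _).trans h2))
    _ = _ := by ring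

end MDP.Regular

/-! ### Rollouts with a geometric horizon -/

theorem abs_sum_range_pow_mul_le {q U : ℝ} (h0 : 0 ≤ q) (h1 : q < 1) {c : ℕ → ℝ}
    (hc : ∀ t, |c t| ≤ U) (n : ℕ) : |∑ t ∈ Finset.range n, q ^ t * c t| ≤ U / (1 - q) := by
  have hU : 0 ≤ U := (abs_nonneg _).trans (hc 0)
  refine (Finset.abs_sum_le_sum_abs _ _).trans ?_
  have h : ∀ t ∈ Finset.range n, |q ^ t * c t| ≤ q ^ t * U := fun t _ => by
    rw [abs_mul, abs_of_nonneg (pow_nonneg h0 t)]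
    exact mul_le_mul_of_nonneg_left (hc t) (pow_nonneg h0 t)
  refine (Finset.sum_le_sum h).trans ?_
  rw [← Finset.sum_mul, div_eq_inv_mul, ← tsum_geometric_of_lt_one h0 h1]
  exact mul_le_mul_of_nonneg_right
    ((summable_geometric_of_lt_one h0 h1).sum_le_tsum _ fun t _ => pow_nonneg h0 t) hU

/-- Averaging the partial sums over a geometric horizon multiplies the `n`-th term by `q ^ n`. -/
theorem tsum_pow_mul_sum_range {q U : ℝ} (h0 : 0 ≤ q) (h1 : q < 1) {c : ℕ → ℝ}
    (hc : ∀ t, |c t| ≤ U) :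
    ∑' n : ℕ, (q ^ n * (1 - q)) * ∑ t ∈ Finset.range (n + 1), q ^ t * c t =
      ∑' n : ℕ, (q ^ 2) ^ n * c n := by
  set s : ℕ → ℝ := fun n => ∑ t ∈ Finset.range (n + 1), q ^ t * c t
  have hs : Summable fun n => q ^ n * s n :=
    summable_pow_mul_of_abs_le h0 h1 fun n => abs_sum_range_pow_mul_le h0 h1 hc (n + 1)
  have hc' : Summable fun n => (q ^ 2) ^ n * c n :=
    summable_pow_mul_of_abs_le (sq_nonneg q) (pow_lt_one₀ h0 h1 two_ne_zero) hc
  have hc1 := (summable_nat_add_iff 1).2 hc'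
  have hrec : ∀ n, q ^ (n + 1) * s (n + 1) = q * (q ^ n * s n) + (q ^ 2) ^ (n + 1) * c (n + 1) :=
    fun n => by
      simp only [s]
      rw [Finset.sum_range_succ _ (n + 1)]
      ring
  -- Summing the recursion gives a linear equation for `∑ q ^ n * s n`; solving it produces the
  -- factor `1 - q`, which is the normalisation of the geometric law.
  have hsum : ∑' n, q ^ n * s n = q * ∑' n, q ^ n * s n + ∑' n, (q ^ 2) ^ n * c n := by
    conv_lhs => rw [hs.tsum_eq_zero_add]
    simp_rw [hrec]
    rw [(hs.mul_left q).tsum_add hc1, tsum_mul_left, hc'.tsum_eq_zero_add]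
    simp [s]
    ring
  have : ∀ n, q ^ n * (1 - q) * s n = (1 - q) * (q ^ n * s n) := fun n => by ring
  rw [tsum_congr this, tsum_mul_left]
  linarith

namespace MDP

variable {d : ℕ} {S A : Type*} [MeasurableSpace S] [MeasurableSpace A] {ν : Measure A}
  {M : MDP S A} {κ : Kernel S A} [IsMarkovKernel κ] {U : ℝ}

theorem abs_rolloutReturn_le (hU : ∀ x, |M.R x| ≤ U) (r : Rollout S A) :
    |M.rolloutReturn r| ≤ U / (1 - √M.γ) :=
  abs_sum_range_pow_mul_le (Real.sqrt_nonneg _) M.sqrt_γ_lt_one (fun t => hU (r.2 t)) _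

theorem measurable_rolloutReturn : Measurable (M.rolloutReturn : Rollout S A → ℝ) :=
  measurable_from_prod_countable_right fun n =>
    Finset.measurable_fun_sum (Finset.range (n + 1)) fun t _ =>
      (M.measurable_R.comp (measurable_pi_apply t)).const_mul (√M.γ ^ t)

theorem integrable_rolloutReturn (hU : ∀ x, |M.R x| ≤ U) (μ : Measure (Rollout S A))
    [IsFiniteMeasure μ] : Integrable M.rolloutReturn μ :=
  measurable_rolloutReturn.integrable_of_norm_le (abs_rolloutReturn_le hU) μ

theorem integral_innerHorizon (f : ℕ → ℝ) :
    ∫ n, f n ∂M.innerHorizon = ∑' n : ℕ, (√M.γ ^ n * (1 - √M.γ)) * f n := by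
  rw [innerHorizon, integral_geometricMeasure]
  · simp
  · intro h
    have h1 := congrArg Subtype.val h
    have h2 := M.sqrt_γ_lt_one
    simp only [Set.Icc.coe_zero] at h1
    linarith

/-- A geometrically stopped return discounted by `γ ^ {1/2}` has the expected discounted return. -/
theorem integral_rolloutReturn (hU : ∀ x, |M.R x| ≤ U) (μ : Measure (ℕ → S × A))
    [IsProbabilityMeasure μ] : ∫ r, M.rolloutReturn r ∂(M.innerHorizon.prod μ) =
      ∫ ω, ∑' t : ℕ, M.γ ^ t * M.R (ω t) ∂μ := by
  rw [integral_prod_symm _ (integrable_rolloutReturn hU _)]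
  refine integral_congr_ae (ae_of_all _ fun ω => ?_)
  simp only [rolloutReturn]
  rw [integral_innerHorizon, tsum_pow_mul_sum_range (Real.sqrt_nonneg _) M.sqrt_γ_lt_one
    (fun t => hU (ω t)), Real.sq_sqrt M.γ_pos.le]

theorem integral_rolloutReturn_rolloutQ (hU : ∀ x, |M.R x| ≤ U) (x : S × A) :
    ∫ r, M.rolloutReturn r ∂(M.rolloutQ κ x) = M.Q κ x := by
  rw [rolloutQ, Kernel.prod_apply, Kernel.const_apply, integral_rolloutReturn hU]
  rfl

theorem integral_rolloutReturn_rolloutV (hU : ∀ x, |M.R x| ≤ U) (s : S) :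
    ∫ r, M.rolloutReturn r ∂(M.rolloutV κ s) = M.V κ s := by
  rw [rolloutV, Kernel.prod_apply, Kernel.const_apply, integral_rolloutReturn hU]
  rfl

/-- The expectation of a quantity depending on the last pair of an outer sample and on fresh
randomness drawn given that pair. -/
theorem integral_outerSample_compProd {Y E : Type*} [MeasurableSpace Y] [NormedAddCommGroup E]
    [NormedSpace ℝ E] [MeasurableSpace E] [BorelSpace E] [SecondCountableTopology E]
    (η : Kernel (S × A) Y) [IsMarkovKernel η] (s₀ : S) {G : (S × A) × Y → E}
    (hG : Measurable G) {C : ℝ} (hC : ∀ z, ‖G z‖ ≤ C) :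
    Integrable (fun ω => G (lastPair ω.1, ω.2))
        ((M.outerSample κ s₀) ⊗ₘ (η.comap lastPair measurable_lastPair)) ∧
      ∫ ω, G (lastPair ω.1, ω.2)
          ∂((M.outerSample κ s₀) ⊗ₘ (η.comap lastPair measurable_lastPair)) =
        ∫ x, ∫ y, G (x, y) ∂(η x) ∂(M.occupancy κ s₀) := by
  have hm : Measurable fun ω : Rollout S A × Y => G (lastPair ω.1, ω.2) :=
    hG.comp ((measurable_lastPair.comp measurable_fst).prodMk measurable_snd)
  have hi := hm.integrable_of_norm_le (fun ω => hC _)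
    ((M.outerSample κ s₀) ⊗ₘ (η.comap lastPair measurable_lastPair))
  have hm' := (hG.stronglyMeasurable.integral_kernel_prod_right' (κ := η)).measurable
  refine ⟨hi, ?_⟩
  rw [Measure.integral_compProd hi, ← map_lastPair_outerSample,
    integral_map measurable_lastPair.aemeasurable hm'.aestronglyMeasurable]
  rfl

/-! ### The three estimators: bounds and unbiasedness -/

namespace Regular

variable {π : ParamPolicy d S ν} {U_R L_Θ B_Θ : ℝ}

theorem abs_div_one_sub_mul_le {c C : ℝ} (hc : |c| ≤ C) :
    |1 / (1 - M.γ) * c| ≤ 1 / (1 - M.γ) * C := by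
  have h : 0 ≤ 1 / (1 - M.γ) := one_div_nonneg.2 (sub_nonneg.2 M.γ_lt_one.le)
  rw [abs_mul, abs_of_nonneg h]
  exact mul_le_mul_of_nonneg_left hc h

theorem norm_gradHat_le (h : M.Regular π U_R L_Θ B_Θ) (θ : EuclideanSpace ℝ (Fin d))
    (ω : Rollout S A × Rollout S A) :
    ‖M.gradHat π θ ω‖ ≤ B_Θ * U_R / ((1 - M.γ) * (1 - √M.γ)) := by
  refine (h.norm_mul_smul_score_le θ
    (abs_div_one_sub_mul_le (abs_rolloutReturn_le h.abs_reward_le _)) _).trans_eq ?_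
  rw [one_div_mul_eq_div, div_div, mul_comm (1 - √M.γ), div_mul_eq_mul_div, mul_comm U_R]

theorem norm_gradCheck_le (h : M.Regular π U_R L_Θ B_Θ) (θ : EuclideanSpace ℝ (Fin d))
    (ω : Rollout S A × (Rollout S A × Rollout S A)) :
    ‖M.gradCheck π θ ω‖ ≤ 2 * B_Θ * U_R / ((1 - M.γ) * (1 - √M.γ)) := by
  refine (h.norm_mul_smul_score_le θ (abs_div_one_sub_mul_le ((abs_sub _ _).trans
    (add_le_add (abs_rolloutReturn_le h.abs_reward_le _)
      (abs_rolloutReturn_le h.abs_reward_le _)))) _).trans_eq ?_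
  have h1 := (sub_pos.2 M.γ_lt_one).ne'
  have h2 := (sub_pos.2 M.sqrt_γ_lt_one).ne'
  field_simp
  ring

/-- The constant comes from `1 + (1 + γ) / (1 - √γ) = (2 + γ - √γ) / (1 - √γ)`: the reward is
observed once, without a rollout. -/
theorem norm_gradTilde_le (h : M.Regular π U_R L_Θ B_Θ) (θ : EuclideanSpace ℝ (Fin d))
    (ω : Rollout S A × ((S × Rollout S A) × Rollout S A)) :
    ‖M.gradTilde π θ ω‖ ≤
      (2 + M.γ - √M.γ) * B_Θ * U_R / ((1 - M.γ) * (1 - √M.γ)) := by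
  have hV : |M.γ * M.rolloutReturn ω.2.1.2| ≤ M.γ * (U_R / (1 - √M.γ)) := by
    rw [abs_mul, abs_of_pos M.γ_pos]
    exact mul_le_mul_of_nonneg_left (abs_rolloutReturn_le h.abs_reward_le _) M.γ_pos.le
  refine (h.norm_mul_smul_score_le θ (abs_div_one_sub_mul_le ((abs_sub _ _).trans
    (add_le_add ((abs_add_le _ _).trans (add_le_add (h.abs_reward_le _) hV))
      (abs_rolloutReturn_le h.abs_reward_le _)))) _).trans_eq ?_
  have h1 := (sub_pos.2 M.γ_lt_one).ne'
  have h2 := (sub_pos.2 M.sqrt_γ_lt_one).ne'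
  field_simp
  ring

variable [SigmaFinite ν]

/-- A baseline depending on the state only does not bias the gradient. -/
theorem integral_baseline_smul_score (h : M.Regular π U_R L_Θ B_Θ)
    (θ : EuclideanSpace ℝ (Fin d)) (s₀ : S) {b : S → ℝ} (hb : Measurable b) {C : ℝ}
    (hC : ∀ s, |b s| ≤ C) :
    ∫ x, b x.1 • π.score θ x ∂(M.occupancy (π.kernel θ) s₀) = 0 := by
  rw [integral_occupancy_eq_integral_integral (f := fun x => b x.1 • π.score θ x)
    ((hb.comp measurable_fst).smul (h.measurable_score θ))
    (fun x => h.norm_mul_smul_score_le θ (hC x.1) x)]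
  simp [integral_smul, h.integral_score_eq_zero]

theorem integral_Q_sub_V_smul_score (h : M.Regular π U_R L_Θ B_Θ)
    (θ : EuclideanSpace ℝ (Fin d)) (s₀ : S) :
    ∫ x, (1 / (1 - M.γ) * (M.Q (π.kernel θ) x - M.V (π.kernel θ) x.1)) • π.score θ x
        ∂(M.occupancy (π.kernel θ) s₀) =
      (1 / (1 - M.γ)) • ∫ x, M.Q (π.kernel θ) x • π.score θ x
        ∂(M.occupancy (π.kernel θ) s₀) := by
  have hVm := measurable_V (κ := π.kernel θ) h.abs_reward_le
  have hVi : Integrable (fun x : S × A => M.V (π.kernel θ) x.1 • π.score θ x)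
      (M.occupancy (π.kernel θ) s₀) :=
    ((hVm.comp measurable_fst).smul (h.measurable_score θ)).integrable_of_norm_le
      (fun x => h.norm_mul_smul_score_le θ (abs_V_le h.abs_reward_le x.1) x) _
  simp_rw [mul_smul, sub_smul]
  rw [integral_smul, integral_sub (h.integrable_Q_smul_score θ s₀) hVi,
    h.integral_baseline_smul_score θ s₀ hVm (abs_V_le h.abs_reward_le), sub_zero]

theorem integral_gradHat (h : M.Regular π U_R L_Θ B_Θ) (θ : EuclideanSpace ℝ (Fin d)) (s₀ : S) :
    Integrable (M.gradHat π θ) (M.lawHat (π.kernel θ) s₀) ∧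
      ∫ ω, M.gradHat π θ ω ∂(M.lawHat (π.kernel θ) s₀) = (1 / (1 - M.γ)) •
        ∫ x, M.Q (π.kernel θ) x • π.score θ x ∂(M.occupancy (π.kernel θ) s₀) := by
  have hG : Measurable fun z : (S × A) × Rollout S A =>
      (1 / (1 - M.γ) * M.rolloutReturn z.2) • π.score θ z.1 :=
    ((measurable_rolloutReturn.comp measurable_snd).const_mul _).smul
      ((h.measurable_score θ).comp measurable_fst)
  have key := integral_outerSample_compProd (M := M) (κ := π.kernel θ) (M.rolloutQ (π.kernel θ))
    s₀ hG (fun z => h.norm_mul_smul_score_le θ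
      (abs_div_one_sub_mul_le (abs_rolloutReturn_le h.abs_reward_le _)) _)
  refine ⟨key.1, key.2.trans ?_⟩
  simp_rw [integral_smul_const, integral_const_mul,
    integral_rolloutReturn_rolloutQ h.abs_reward_le, mul_smul]
  rw [integral_smul]

theorem integral_gradCheck (h : M.Regular π U_R L_Θ B_Θ) (θ : EuclideanSpace ℝ (Fin d)) (s₀ : S) :
    Integrable (M.gradCheck π θ) (M.lawCheck (π.kernel θ) s₀) ∧
      ∫ ω, M.gradCheck π θ ω ∂(M.lawCheck (π.kernel θ) s₀) = (1 / (1 - M.γ)) •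
        ∫ x, M.Q (π.kernel θ) x • π.score θ x ∂(M.occupancy (π.kernel θ) s₀) := by
  have hret := measurable_rolloutReturn (M := M)
  have hG : Measurable fun z : (S × A) × (Rollout S A × Rollout S A) =>
      (1 / (1 - M.γ) * (M.rolloutReturn z.2.1 - M.rolloutReturn z.2.2)) • π.score θ z.1 :=
    (((hret.comp (measurable_fst.comp measurable_snd)).sub
      (hret.comp (measurable_snd.comp measurable_snd))).const_mul _).smul
        ((h.measurable_score θ).comp measurable_fst)
  have key := integral_outerSample_compProd (M := M) (κ := π.kernel θ)
    ((M.rolloutQ (π.kernel θ)).prod ((M.rolloutV (π.kernel θ)).comap Prod.fst measurable_fst))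
    s₀ hG (fun z => h.norm_mul_smul_score_le θ (abs_div_one_sub_mul_le ((abs_sub _ _).trans
      (add_le_add (abs_rolloutReturn_le h.abs_reward_le _)
        (abs_rolloutReturn_le h.abs_reward_le _)))) _)
  refine ⟨key.1, key.2.trans ?_⟩
  -- With the baseline `V` restored in the target, it suffices to match conditional means at each
  -- fixed pair `x`. By linearity only the marginal mean of each rollout enters.
  rw [← h.integral_Q_sub_V_smul_score θ s₀]
  refine integral_congr_ae (ae_of_all _ fun x => ?_)
  simp only
  rw [integral_smul_const, integral_const_mul, Kernel.prod_apply, Kernel.comap_apply,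
    integral_sub ((integrable_rolloutReturn h.abs_reward_le _).comp_fst _)
      ((integrable_rolloutReturn h.abs_reward_le _).comp_snd _),
    integral_fun_fst, integral_fun_snd, integral_rolloutReturn_rolloutQ h.abs_reward_le,
    integral_rolloutReturn_rolloutV h.abs_reward_le]
  simp

theorem integral_gradTilde (h : M.Regular π U_R L_Θ B_Θ) (θ : EuclideanSpace ℝ (Fin d)) (s₀ : S) :
    Integrable (M.gradTilde π θ) (M.lawTilde (π.kernel θ) s₀) ∧
      ∫ ω, M.gradTilde π θ ω ∂(M.lawTilde (π.kernel θ) s₀) = (1 / (1 - M.γ)) •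
        ∫ x, M.Q (π.kernel θ) x • π.score θ x ∂(M.occupancy (π.kernel θ) s₀) := by
  have hret := measurable_rolloutReturn (M := M)
  have hG : Measurable fun z : (S × A) × ((S × Rollout S A) × Rollout S A) =>
      (1 / (1 - M.γ) * (M.R z.1 + M.γ * M.rolloutReturn z.2.1.2 - M.rolloutReturn z.2.2)) •
        π.score θ z.1 :=
    ((((M.measurable_R.comp measurable_fst).add ((hret.comp (measurable_snd.comp
      (measurable_fst.comp measurable_snd))).const_mul _)).sub
      (hret.comp (measurable_snd.comp measurable_snd))).const_mul _).smul
        ((h.measurable_score θ).comp measurable_fst)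
  have hV : ∀ r : Rollout S A, |M.γ * M.rolloutReturn r| ≤ M.γ * (U_R / (1 - √M.γ)) := fun r => by
    rw [abs_mul, abs_of_pos M.γ_pos]
    exact mul_le_mul_of_nonneg_left (abs_rolloutReturn_le h.abs_reward_le _) M.γ_pos.le
  have key := integral_outerSample_compProd (M := M) (κ := π.kernel θ)
    ((M.P.compProd (Kernel.prodMkLeft (S × A) (M.rolloutV (π.kernel θ)))).prod
      ((M.rolloutV (π.kernel θ)).comap Prod.fst measurable_fst))
    s₀ hG (fun z => h.norm_mul_smul_score_le θ (abs_div_one_sub_mul_le ((abs_sub _ _).trans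
      (add_le_add ((abs_add_le _ _).trans (add_le_add (h.abs_reward_le _) (hV _)))
        (abs_rolloutReturn_le h.abs_reward_le _)))) _)
  refine ⟨key.1, key.2.trans ?_⟩
  rw [← h.integral_Q_sub_V_smul_score θ s₀]
  refine integral_congr_ae (ae_of_all _ fun x => ?_)
  simp only
  set μ := (M.P.compProd (Kernel.prodMkLeft (S × A) (M.rolloutV (π.kernel θ)))) x with hμ
  have hi : Integrable (fun y : S × Rollout S A => M.rolloutReturn y.2) μ :=
    (hret.comp measurable_snd).integrable_of_norm_le
      (fun y => abs_rolloutReturn_le h.abs_reward_le _) _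
  -- Averaging the rollout given the fresh next state yields the term that the Bellman equation
  -- turns, with the reward, into `Q`.
  have hnext : ∫ y, M.rolloutReturn y.2 ∂μ = ∫ s, M.V (π.kernel θ) s ∂(M.P x) := by
    rw [hμ, integral_compProd hi]
    simp_rw [Kernel.prodMkLeft_apply, integral_rolloutReturn_rolloutV h.abs_reward_le]
  have hnext' : Integrable (fun y : (S × Rollout S A) × Rollout S A =>
      M.R x + M.γ * M.rolloutReturn y.1.2) (μ.prod (M.rolloutV (π.kernel θ) x.1)) :=
    ((integrable_const (M.R x)).add (hi.const_mul M.γ)).comp_fst _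
  rw [integral_smul_const, integral_const_mul, Kernel.prod_apply, Kernel.comap_apply, ← hμ,
    integral_sub hnext' ((integrable_rolloutReturn h.abs_reward_le _).comp_snd _),
    integral_fun_fst (fun y : S × Rollout S A => M.R x + M.γ * M.rolloutReturn y.2),
    integral_fun_snd, integral_rolloutReturn_rolloutV h.abs_reward_le,
    integral_add (integrable_const _) (hi.const_mul _), integral_const_mul, hnext,
    Q_eq_reward_add h.abs_reward_le]
  simp

end Regular

end MDP

theorem theorem1 {S A : Type*} [MeasurableSpace S] [MeasurableSpace A]
    {ν : Measure A} [SigmaFinite ν] {d : ℕ} (M : MDP S A) (π : ParamPolicy d S ν) (s₀ : S)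
    (U_R L_Θ B_Θ : ℝ) (h : M.Regular π U_R L_Θ B_Θ) :
    (∀ θ : EuclideanSpace ℝ (Fin d),
      -- the gradient of the objective exists and has the policy gradient form
      (DifferentiableAt ℝ (M.J π s₀) θ ∧
        Integrable (fun x => M.Q (π.kernel θ) x • π.score θ x)
          (M.occupancy (π.kernel θ) s₀) ∧
        ∇ (M.J π s₀) θ = (1 / (1 - M.γ)) •
          ∫ x, M.Q (π.kernel θ) x • π.score θ x ∂(M.occupancy (π.kernel θ) s₀)) ∧
      -- unbiasedness
      (Integrable (M.gradHat π θ) (M.lawHat (π.kernel θ) s₀) ∧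
        ∫ ω, M.gradHat π θ ω ∂(M.lawHat (π.kernel θ) s₀) = ∇ (M.J π s₀) θ) ∧
      (Integrable (M.gradCheck π θ) (M.lawCheck (π.kernel θ) s₀) ∧
        ∫ ω, M.gradCheck π θ ω ∂(M.lawCheck (π.kernel θ) s₀) = ∇ (M.J π s₀) θ) ∧
      (Integrable (M.gradTilde π θ) (M.lawTilde (π.kernel θ) s₀) ∧
        ∫ ω, M.gradTilde π θ ω ∂(M.lawTilde (π.kernel θ) s₀) = ∇ (M.J π s₀) θ) ∧
      -- boundedness
      ‖∇ (M.J π s₀) θ‖ ≤ B_Θ * U_R / (1 - M.γ) ^ 2 ∧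
      (∀ᵐ ω ∂(M.lawHat (π.kernel θ) s₀),
        ‖M.gradHat π θ ω‖ ≤ B_Θ * U_R / ((1 - M.γ) * (1 - √M.γ))) ∧
      (∀ᵐ ω ∂(M.lawCheck (π.kernel θ) s₀),
        ‖M.gradCheck π θ ω‖ ≤ 2 * B_Θ * U_R / ((1 - M.γ) * (1 - √M.γ))) ∧
      (∀ᵐ ω ∂(M.lawTilde (π.kernel θ) s₀),
        ‖M.gradTilde π θ ω‖ ≤
          (2 + M.γ - √M.γ) * B_Θ * U_R / ((1 - M.γ) * (1 - √M.γ)))) ∧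
    -- the three almost sure bounds are positive constants unless the reward bound is zero
    (0 < U_R →
      0 < B_Θ * U_R / ((1 - M.γ) * (1 - √M.γ)) ∧
      0 < 2 * B_Θ * U_R / ((1 - M.γ) * (1 - √M.γ)) ∧
      0 < (2 + M.γ - √M.γ) * B_Θ * U_R / ((1 - M.γ) * (1 - √M.γ))) := by
  have h1 := sub_pos.2 M.γ_lt_one
  have h2 := sub_pos.2 M.sqrt_γ_lt_one
  refine ⟨fun θ => ?_, fun hU => ?_⟩
  · have hJ := h.hasGradientAt_J s₀ θ
    rw [hJ.gradient]
    refine ⟨⟨hJ.differentiableAt, h.integrable_Q_smul_score θ s₀, rfl⟩, h.integral_gradHat θ s₀,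
      h.integral_gradCheck θ s₀, h.integral_gradTilde θ s₀, ?_,
      ae_of_all _ (h.norm_gradHat_le θ), ae_of_all _ (h.norm_gradCheck_le θ),
      ae_of_all _ (h.norm_gradTilde_le θ)⟩
    rw [norm_smul, Real.norm_of_nonneg (one_div_nonneg.2 h1.le)]
    refine (mul_le_mul_of_nonneg_left (norm_integral_le_of_forall_norm_le
      (h.norm_Q_smul_score_le θ) _) (one_div_nonneg.2 h1.le)).trans_eq ?_
    field_simp
  · have hB := h.B_pos
    have h3 : 0 < 2 + M.γ - √M.γ := by linarith [M.γ_pos]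
    exact ⟨by positivity, by positivity, by positivity⟩
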